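/- Let $k$ be a field of characteristic zero. Let $T$ be the vector space spanned by the (isomorphism classes of) nonempty non-planar rooted trees, $T'$ the one spanned by those with at least one edge, and $\bullet$ the one-vertex tree. As algebras, $\widetilde{\mathcal H}=\mathcal H_{CK}=S(T)$ and $\mathcal H=S(T')$, the unit of $\mathcal H$ being identified with $\bullet$. The Connes--Kreimer coproduct on $\mathcal H_{CK}$ is the algebra morphism with $\Delta_{CK}(t)=t\otimes 1+\sum_c P^c(t)\otimes R^c(t)$, where $c$ runs over the admissible cuts of the tree $t$ (including the empty cut), $P^c(t)$ is the pruned forest and $R^c(t)$ the trunk; $*$ denotes the corresponding convolution of linear forms on $\mathcal H_{CK}$, and $\varepsilon$ the counit. Let $\Phi:\mathcal H_{CK}\to\mathcal H\otimes\mathcal H_{CK}$ (respectively $\widetilde\Phi:\mathcal H_{CK}\to\widetilde{\mathcal H}\otimes\mathcal H_{CK}$) be the algebra morphism with $t\mapsto\sum_{s} s\otimes t/s$ for every nonempty tree $t$, where $s$ runs over the subforests of $t$ whose components have at least one edge, including the trivial subforest (respectively over the spanning subforests of $t$), and $t/s$ is the tree obtained by contracting each component of $s$ to a vertex. For a linear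 form $\varphi$ on $\mathcal H$ (respectively $\widetilde{\mathcal H}$) and a linear form $b$ on $\mathcal H_{CK}$ put $\varphi\star b=(\varphi\otimes b)\circ\Phi$ (respectively $(\varphi\otimes b)\circ\widetilde\Phi$). Characters are unital algebra morphisms to $k$; an infinitesimal character of $\mathcal H_{CK}$ is a linear form $\xi$ with $\xi(xy)=\xi(x)\varepsilon(y)+\varepsilon(x)\xi(y)$. Let $\delta_\bullet$ be the element dual to $\bullet$ in the dual of the forest basis of $\mathcal H_{CK}$, and $\delta$ the character of $\mathcal H_{CK}$ with $\delta(\bullet)=1$ and $\delta(t)=0$ for every other nonempty tree $t$. 1. For every character $\varphi$ of $\mathcal H$, $\varphi\star\delta_\bullet$ is the unique infinitesimal character of $\mathcal H_{CK}$ that coincides with $\varphi$ on nonempty trees, and $\varphi\mapsto\varphi\star\delta_\bullet$ is a bijection from the characters of $\mathcal H$ onto the infinitesimal characters of $\mathcal H_{CK}$ taking the value $1$ on $\bullet$. 2. For every character $\varphi$ of $\mathcal H$, $\varphi\star\delta$ is the unique character of $\mathcal H_{CK}$ that coincides with $\varphi$ on nonempty trees, and $\varphi\mapsto\varphi\star\delta$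 is a bijection from the characters of $\mathcal H$ onto the characters of $\mathcal H_{CK}$ taking the value $1$ on $\bullet$. 3. For every character $\varphi$ of $\widetilde{\mathcal H}$, $\varphi\star\delta_\bullet$ is the unique infinitesimal character of $\mathcal H_{CK}$ that coincides with $\varphi$ on nonempty trees, and $\varphi\mapsto\varphi\star\delta_\bullet$ is a bijection from the characters of $\widetilde{\mathcal H}$ onto the infinitesimal characters of $\mathcal H_{CK}$. 4. For every character $\varphi$ of $\widetilde{\mathcal H}$, $\varphi\star\delta$ is the unique character of $\mathcal H_{CK}$ that coincides with $\varphi$ on nonempty trees, and $\varphi\mapsto\varphi\star\delta$ is a bijection from the characters of $\widetilde{\mathcal H}$ onto the characters of $\mathcal H_{CK}$. 5. The form $\delta$ is a character, and every character $b$ of $\mathcal H_{CK}$ has a unique inverse $b^{*-1}$ for the convolution $*$. If $b$ is a character of $\mathcal H_{CK}$ with $b(\bullet)=1$ and $\widetilde b$ is the character of $\mathcal H$ with $b=\widetilde b\star\delta$, then $b^{*-1}=\widetilde b\star\delta^{*-1}$. Likewise, if $b$ is any character of $\mathcal H_{CK}$ and $\widetilde b$ is the character of $\widetilde{\mathcal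 H}$ with $b=\widetilde b\star\delta$, then $b^{*-1}=\widetilde b\star\delta^{*-1}$. -/

import Mathlib

open scoped TensorProduct

namespace TreeHopf

/-! ### Rooted trees -/

/-- Planar representatives of nonempty finite rooted trees.  `dot` is the one-vertex tree, and
`graft c t` is the tree obtained from `t` by adding one more branch `c` at its root, i.e. by adding
a new edge from the root of `t` to the root of `c`.  So every edge of a tree corresponds to exactly
one occurrence of `graft`. -/
inductive PTree : Type
  | dot : PTree
  | graft (c t : PTree) : PTree

namespace PTree

/-- Isomorphism of rooted trees: the congruence generated by permuting the branches at a vertex. -/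
inductive Iso : PTree → PTree → Prop
  | refl (t : PTree) : Iso t t
  | symm {t u : PTree} : Iso t u → Iso u t
  | trans {t u v : PTree} : Iso t u → Iso u v → Iso t v
  | congr {c c' t t' : PTree} : Iso c c' → Iso t t' → Iso (graft c t) (graft c' t')
  | swap (a b t : PTree) : Iso (graft a (graft b t)) (graft b (graft a t))

instance isoSetoid : Setoid PTree := ⟨Iso, ⟨Iso.refl, Iso.symm, Iso.trans⟩⟩

/-- Identify the roots of two trees: the branches of the result are the branches of both. -/
def merge : PTree → PTree → PTree
  | dot, u => u
  | graft c t, u => graft c (merge t u)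

/-! #### Subforests and contractions -/

/-- A set of edges of `t`: one Boolean for each edge (`true`: the edge belongs to the set).  In
`(b, S, S') : EdgeSet (graft c t)`, the Boolean `b` is about the edge from the root of `t` to the
root of `c`, and `S`, `S'` are the parts of the set inside `c` and `t`.

A spanning subforest of `t` (a partition of the vertices of `t` into subtrees) is the same thing as
the set of edges of its components, and so is a collection of pairwise disjoint subtrees of `t` with
at least one edge each. -/
def EdgeSet : PTree → Type
  | dot => Unit
  | graft c t => Bool × EdgeSet c × EdgeSet t

instance edgeSetFintype : (t : PTree) → Fintype (EdgeSet t)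
  | dot => inferInstanceAs (Fintype Unit)
  | graft c t =>
    letI := edgeSetFintype c
    letI := edgeSetFintype t
    inferInstanceAs (Fintype (Bool × EdgeSet c × EdgeSet t))

/-- The connected component of the root of `t` in the spanning subforest with edge set `S`. -/
def rootComp : (t : PTree) → EdgeSet t → PTree
  | dot, _ => dot
  | graft c t, (true, S, S') => graft (rootComp c S) (rootComp t S')
  | graft _ t, (false, _, S') => rootComp t S'

/-- The connected components not containing the root of `t`. -/
def otherComps : (t : PTree) → EdgeSet t → Multiset PTree
  | dot, _ => 0
  | graft c t, (true, S, S') => otherComps c S + otherComps t S'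
  | graft c t, (false, S, S') => rootComp c S ::ₘ (otherComps c S + otherComps t S')

/-- All connected components of the spanning subforest of `t` with edge set `S`. -/
def comps (t : PTree) (S : EdgeSet t) : Multiset PTree := rootComp t S ::ₘ otherComps t S

/-- The tree obtained from `t` by contracting each edge in `S`, i.e. by contracting each connected
component of the subforest to a vertex. -/
def contract : (t : PTree) → EdgeSet t → PTree
  | dot, _ => dot
  | graft c t, (true, S, S') => merge (contract c S) (contract t S')
  | graft c t, (false, S, S') => graft (contract c S) (contract t S')

/-! #### Admissible cuts -/

/-- Admissible cuts of `t` (including the empty cut, excluding the total cut): sets of edges such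
that each path from the root to a leaf meets the set at most once.  In
`(o, w) : AdmCut (graft c t)`, `o = none` means that the edge from the root of `t` to the root of
`c` is cut (and hence no edge of `c`), `o = some v` means that this edge is not cut and that `c` is
cut along `v`; `w` is the part of the cut inside `t`. -/
def AdmCut : PTree → Type
  | dot => Unit
  | graft c t => Option (AdmCut c) × AdmCut t

instance admCutFintype : (t : PTree) → Fintype (AdmCut t)
  | dot => inferInstanceAs (Fintype Unit)
  | graft c t =>
    letI := admCutFintype c
    letI := admCutFintype t
    inferInstanceAs (Fintype (Option (AdmCut c) × AdmCut t))

/-- The trunk of an admissible cut: the part of the tree that still contains the root. -/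
def trunk : (t : PTree) → AdmCut t → PTree
  | dot, _ => dot
  | graft _ t, (none, w) => trunk t w
  | graft c t, (some v, w) => graft (trunk c v) (trunk t w)

/-- The pruning (crown) of an admissible cut: the forest of all branches that are cut off. -/
def crown : (t : PTree) → AdmCut t → Multiset PTree
  | dot, _ => 0
  | graft c t, (none, w) => c ::ₘ crown t w
  | graft c t, (some v, w) => crown c v + crown t w

end PTree

/-- Isomorphism classes of nonempty (non-planar) rooted trees. -/
def RTree : Type := Quotient PTree.isoSetoid

/-- The isomorphism class of a planar representative. -/
def RTree.mk (t : PTree) : RTree := Quotient.mk _ t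

/-- The one-vertex tree. -/
def RTree.dot : RTree := RTree.mk PTree.dot

namespace PTree

/-! #### Independence of the planar representative -/

theorem mk_eq {t u : PTree} (h : Iso t u) : RTree.mk t = RTree.mk u := Quotient.sound h

theorem iso_of_mk_eq {t u : PTree} (h : RTree.mk t = RTree.mk u) : Iso t u := Quotient.exact h

theorem merge_congr_right (a : PTree) {b b' : PTree} (h : Iso b b') :
    Iso (merge a b) (merge a b') := by
  induction a with
  | dot => exact h
  | graft c t _ ih => exact .congr (.refl c) ih

theorem merge_congr_left {a a' : PTree} (h : Iso a a') (b : PTree) :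
    Iso (merge a b) (merge a' b) := by
  induction h with
  | refl t => exact .refl _
  | symm _ ih => exact .symm ih
  | trans _ _ ih₁ ih₂ => exact .trans ih₁ ih₂
  | congr hc _ _ ih => exact .congr hc ih
  | swap x y t => exact .swap _ _ _

theorem merge_congr {a a' b b' : PTree} (h : Iso a a') (h' : Iso b b') :
    Iso (merge a b) (merge a' b') :=
  .trans (merge_congr_left h b) (merge_congr_right a' h')

theorem merge_graft (a c t : PTree) : Iso (merge a (graft c t)) (graft c (merge a t)) := by
  induction a with
  | dot => exact .refl _
  | graft x a _ ih => exact .trans (.congr (.refl x) ih) (.swap _ _ _)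

theorem merge_left_comm (a b t : PTree) :
    Iso (merge a (merge b t)) (merge b (merge a t)) := by
  induction a with
  | dot => exact .refl _
  | graft x a _ ih => exact .trans (.congr (.refl x) ih) (.symm (merge_graft b x (merge a t)))

theorem exists_edgeSet_equiv {t u : PTree} (h : Iso t u) :
    ∃ e : EdgeSet t ≃ EdgeSet u, ∀ S,
      RTree.mk (rootComp t S) = RTree.mk (rootComp u (e S)) ∧
      (otherComps t S).map RTree.mk = (otherComps u (e S)).map RTree.mk ∧
      RTree.mk (contract t S) = RTree.mk (contract u (e S)) := by
  induction h with
  | refl t => exact ⟨Equiv.refl _, fun S => ⟨rfl, rfl, rfl⟩⟩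
  | symm _ ih =>
    obtain ⟨e, he⟩ := ih
    refine ⟨e.symm, fun S => ?_⟩
    have := he (e.symm S)
    rw [Equiv.apply_symm_apply] at this
    exact ⟨this.1.symm, this.2.1.symm, this.2.2.symm⟩
  | trans _ _ ih₁ ih₂ =>
    obtain ⟨e, he⟩ := ih₁
    obtain ⟨f, hf⟩ := ih₂
    exact ⟨e.trans f, fun S => ⟨(he S).1.trans (hf _).1, (he S).2.1.trans (hf _).2.1,
      (he S).2.2.trans (hf _).2.2⟩⟩
  | congr _ _ ih₁ ih₂ =>
    obtain ⟨e, he⟩ := ih₁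
    obtain ⟨f, hf⟩ := ih₂
    refine ⟨Equiv.prodCongr (Equiv.refl Bool) (Equiv.prodCongr e f), ?_⟩
    rintro ⟨b, S, S'⟩
    obtain ⟨h1, h2, h3⟩ := he S
    obtain ⟨h1', h2', h3'⟩ := hf S'
    cases b
    · refine ⟨h1', ?_, mk_eq (.congr (iso_of_mk_eq h3) (iso_of_mk_eq h3'))⟩
      change Multiset.map RTree.mk (_ ::ₘ (_ + _)) = Multiset.map RTree.mk (_ ::ₘ (_ + _))
      rw [Multiset.map_cons, Multiset.map_cons, Multiset.map_add, Multiset.map_add, h1, h2, h2']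
    · refine ⟨mk_eq (.congr (iso_of_mk_eq h1) (iso_of_mk_eq h1')), ?_,
        mk_eq (merge_congr (iso_of_mk_eq h3) (iso_of_mk_eq h3'))⟩
      change Multiset.map RTree.mk (_ + _) = Multiset.map RTree.mk (_ + _)
      rw [Multiset.map_add, Multiset.map_add, h2, h2']
  | swap a b t =>
    refine ⟨⟨fun S => (S.2.2.1, S.2.2.2.1, S.1, S.2.1, S.2.2.2.2),
      fun S => (S.2.2.1, S.2.2.2.1, S.1, S.2.1, S.2.2.2.2), fun _ => rfl, fun _ => rfl⟩, ?_⟩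
    rintro ⟨x, S, y, S', S''⟩
    cases x <;> cases y
    · refine ⟨rfl, congrArg _ ?_, mk_eq (.swap _ _ _)⟩
      change rootComp a S ::ₘ (otherComps a S + rootComp b S' ::ₘ (otherComps b S' + _)) =
        rootComp b S' ::ₘ (otherComps b S' + rootComp a S ::ₘ (otherComps a S + _))
      simp only [Multiset.add_cons]
      rw [Multiset.cons_swap, add_left_comm]
    · refine ⟨rfl, congrArg _ ?_, mk_eq (.symm (merge_graft _ _ _))⟩
      change rootComp a S ::ₘ (otherComps a S + (otherComps b S' + _)) =
        otherComps b S' + rootComp a S ::ₘ (otherComps a S + _)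
      simp only [Multiset.add_cons]
      rw [add_left_comm]
    · refine ⟨rfl, congrArg _ ?_, mk_eq (merge_graft _ _ _)⟩
      change otherComps a S + rootComp b S' ::ₘ (otherComps b S' + _) =
        rootComp b S' ::ₘ (otherComps b S' + (otherComps a S + _))
      simp only [Multiset.add_cons]
      rw [add_left_comm]
    · refine ⟨mk_eq (.swap _ _ _), congrArg _ ?_, mk_eq (merge_left_comm _ _ _)⟩
      exact add_left_comm _ _ _

theorem exists_admCut_equiv {t u : PTree} (h : Iso t u) :
    ∃ e : AdmCut t ≃ AdmCut u, ∀ w,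
      RTree.mk (trunk t w) = RTree.mk (trunk u (e w)) ∧
      (crown t w).map RTree.mk = (crown u (e w)).map RTree.mk := by
  induction h with
  | refl t => exact ⟨Equiv.refl _, fun S => ⟨rfl, rfl⟩⟩
  | symm _ ih =>
    obtain ⟨e, he⟩ := ih
    refine ⟨e.symm, fun S => ?_⟩
    have := he (e.symm S)
    rw [Equiv.apply_symm_apply] at this
    exact ⟨this.1.symm, this.2.symm⟩
  | trans _ _ ih₁ ih₂ =>
    obtain ⟨e, he⟩ := ih₁
    obtain ⟨f, hf⟩ := ih₂
    exact ⟨e.trans f, fun S => ⟨(he S).1.trans (hf _).1, (he S).2.trans (hf _).2⟩⟩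
  | congr hc _ ih₁ ih₂ =>
    obtain ⟨e, he⟩ := ih₁
    obtain ⟨f, hf⟩ := ih₂
    refine ⟨Equiv.prodCongr (Equiv.optionCongr e) f, ?_⟩
    rintro ⟨_ | v, w⟩
    · refine ⟨(hf w).1, ?_⟩
      change Multiset.map RTree.mk (_ ::ₘ _) = Multiset.map RTree.mk (_ ::ₘ _)
      rw [Multiset.map_cons, Multiset.map_cons, mk_eq hc, (hf w).2]
    · refine ⟨mk_eq (.congr (iso_of_mk_eq (he v).1) (iso_of_mk_eq (hf w).1)), ?_⟩
      change Multiset.map RTree.mk (_ + _) = Multiset.map RTree.mk (_ + _)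
      rw [Multiset.map_add, Multiset.map_add, (he v).2, (hf w).2]
  | swap a b t =>
    refine ⟨⟨fun S => (S.2.1, S.1, S.2.2), fun S => (S.2.1, S.1, S.2.2),
      fun _ => rfl, fun _ => rfl⟩, ?_⟩
    rintro ⟨_ | v, _ | v', w⟩
    · exact ⟨rfl, congrArg _ (Multiset.cons_swap _ _ _)⟩
    · exact ⟨rfl, congrArg _ (Multiset.add_cons _ _ _).symm⟩
    · exact ⟨rfl, congrArg _ (Multiset.add_cons _ _ _)⟩
    · exact ⟨mk_eq (.swap _ _ _), congrArg _ (add_left_comm _ _ _)⟩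

end PTree

/-! ### The algebras -/

noncomputable section

variable (k : Type*) [Field k]

/-- The Connes-Kreimer algebra of rooted forests: the free commutative algebra on the nonempty
rooted trees.  Its basis of monomials consists of the rooted forests, and `1` is the empty forest. -/
abbrev HCK : Type _ := MvPolynomial RTree k

/-- The algebra underlying the rooted tree bialgebra `H̃`: the free commutative algebra on all
nonempty rooted trees. -/
abbrev HTilde : Type _ := MvPolynomial RTree k

/-- The algebra underlying the rooted tree Hopf algebra `H`: the free commutative algebra on the
rooted trees with at least one edge.  Its unit is identified with the one-vertex tree. -/
abbrev H : Type _ := MvPolynomial {t : RTree // t ≠ RTree.dot} k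

variable {k}

/-- A rooted tree as an element of the Connes-Kreimer algebra. -/
def HCK.tree (t : RTree) : HCK k := MvPolynomial.X t

/-- A rooted tree as an element of `H̃`. -/
def HTilde.tree (t : RTree) : HTilde k := MvPolynomial.X t

open Classical in
/-- A nonempty rooted tree as an element of `H`; the one-vertex tree is the unit of `H`. -/
def H.tree (t : RTree) : H k := if h : t = RTree.dot then 1 else MvPolynomial.X ⟨t, h⟩

/-! ### Coproduct and coactions -/

/-- `∑ s ⊗ t/s` over all subforests `s` of the tree `t`, the components of `s` being viewed in an
algebra `B` through `ι`. -/
def subforestSum {B : Type*} [CommRing B] [Algebra k B] (ι : RTree → B) : RTree → B ⊗[k] HCK k :=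
  Quotient.lift
    (fun t : PTree => ∑ S : t.EdgeSet,
      (((t.comps S).map fun c => ι (RTree.mk c)).prod ⊗ₜ[k] HCK.tree (RTree.mk (t.contract S))))
    (by
      intro t u h
      obtain ⟨e, he⟩ := PTree.exists_edgeSet_equiv h
      refine Fintype.sum_equiv e _ _ fun S => ?_
      obtain ⟨h1, h2, h3⟩ := he S
      have hc : (t.comps S).map RTree.mk = (u.comps (e S)).map RTree.mk := by
        simp only [PTree.comps, Multiset.map_cons, h1, h2]
      have hι := congrArg (fun m => (Multiset.map ι m).prod) hc
      simp only [Multiset.map_map, Function.comp_def] at hι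
      rw [hι, h3])

/-- The left coaction `Φ : H_CK → H ⊗ H_CK`: the algebra morphism with `Φ(t) = ∑ s ⊗ t/s` for each
nonempty tree `t`.  Components of `s` with one vertex are the unit of `H`. -/
def coactH : HCK k →ₐ[k] H k ⊗[k] HCK k := MvPolynomial.aeval (subforestSum H.tree)

/-- The left coaction `H_CK → H̃ ⊗ H_CK`: the algebra morphism with `t ↦ ∑ s ⊗ t/s` for each nonempty
tree `t`, the sum being over the spanning subforests.  Under the identification of the algebras
`H_CK` and `H̃`, this is the coproduct of `H̃`. -/
def coactHTilde : HCK k →ₐ[k] HTilde k ⊗[k] HCK k := MvPolynomial.aeval (subforestSum HTilde.tree)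

/-- `t ⊗ 1 + ∑ P^c(t) ⊗ R^c(t)` over the admissible cuts `c` of `t` (the empty cut gives the term
`1 ⊗ t`, and `t ⊗ 1` is the term of the total cut). -/
def cutSum : RTree → HCK k ⊗[k] HCK k :=
  Quotient.lift
    (fun t : PTree => HCK.tree (RTree.mk t) ⊗ₜ[k] 1 + ∑ w : t.AdmCut,
      (((t.crown w).map fun c => HCK.tree (RTree.mk c)).prod ⊗ₜ[k] HCK.tree (RTree.mk (t.trunk w))))
    (by
      intro t u h
      obtain ⟨e, he⟩ := PTree.exists_admCut_equiv h
      refine congrArg₂ (· + ·) (by rw [PTree.mk_eq h]) (Fintype.sum_equiv e _ _ fun w => ?_)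
      obtain ⟨h1, h2⟩ := he w
      have hι := congrArg (fun m => (Multiset.map (HCK.tree (k := k)) m).prod) h2
      simp only [Multiset.map_map, Function.comp_def] at hι
      rw [hι, h1])

/-- The Connes-Kreimer coproduct. -/
def coprodCK : HCK k →ₐ[k] HCK k ⊗[k] HCK k := MvPolynomial.aeval cutSum

/-! ### Linear forms -/

/-- Characters: unital algebra morphisms to the ground field. -/
def IsCharacter {A : Type*} [CommRing A] [Algebra k A] (f : A →ₗ[k] k) : Prop :=
  f 1 = 1 ∧ ∀ x y, f (x * y) = f x * f y

/-- The counit of the Connes-Kreimer Hopf algebra: the coefficient of the empty forest. -/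
def counitCK : HCK k →ₗ[k] k := MvPolynomial.lcoeff k 0

/-- Infinitesimal characters of the Connes-Kreimer Hopf algebra. -/
def IsInfChar (f : HCK k →ₗ[k] k) : Prop :=
  ∀ x y, f (x * y) = f x * counitCK y + counitCK x * f y

/-- The convolution product `f * g` on linear forms on the Connes-Kreimer Hopf algebra. -/
def convCK (f g : HCK k →ₗ[k] k) : HCK k →ₗ[k] k :=
  LinearMap.mul' k k ∘ₗ TensorProduct.map f g ∘ₗ coprodCK.toLinearMap

/-- `g` is the inverse `f^{*-1}` of `f` for the convolution product. -/
def IsConvInv (f g : HCK k →ₗ[k] k) : Prop :=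
  convCK f g = counitCK ∧ convCK g f = counitCK

/-- The left action `φ ⋆ b = (φ ⊗ b) ∘ Φ` of linear forms on `H` on linear forms on `H_CK`. -/
def starH (φ : H k →ₗ[k] k) (b : HCK k →ₗ[k] k) : HCK k →ₗ[k] k :=
  LinearMap.mul' k k ∘ₗ TensorProduct.map φ b ∘ₗ coactH.toLinearMap

/-- The left action `φ ⋆ b` of linear forms on `H̃` on linear forms on `H_CK`. -/
def starHTilde (φ : HTilde k →ₗ[k] k) (b : HCK k →ₗ[k] k) : HCK k →ₗ[k] k :=
  LinearMap.mul' k k ∘ₗ TensorProduct.map φ b ∘ₗ coactHTilde.toLinearMap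

variable (k)

/-- The element `δ_•` of the dual basis of the forest basis: the coefficient of the forest `•`. -/
def deltaDot : HCK k →ₗ[k] k := MvPolynomial.lcoeff k (Finsupp.single RTree.dot 1)

open Classical in
/-- The character `δ` with `δ(•) = 1` and `δ(t) = 0` for any other nonempty tree `t`. -/
def deltaChar : HCK k →ₗ[k] k :=
  (MvPolynomial.aeval fun t : RTree => if t = RTree.dot then (1 : k) else 0).toLinearMap

end

end TreeHopf

/-! Contracting a spanning subforest of `t` gives `•` only when every edge is contracted, and then
the subforest is `t` itself. Both `δ` and `δ_•` are 1 on `•` and 0 on all other trees, so `φ ⋆ δ`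
and `φ ⋆ δ_•` agree with `φ` on trees (`starHTilde_tree_of_dot`). The action of a character
preserves characters and infinitesimal characters, forms of either kind are determined by their
values on trees, and a character of a free algebra may take any values on the generators. This
yields the bijections for `H̃`; those for `H` follow by pulling back along the projection `• ↦ 1`
(`starH_eq`), which forces the value 1 on `•`.

The inverse of `δ` is the character `σ` equal to `-1` to the number of vertices
(`convCK_signHom_deltaChar`). Since `t/s` has one vertex for each component of `s`, `(φ ⋆ σ)(t)` is
the sum over spanning subforests of the product of `-φ(c)` over the components `c`. A spanning
subforest amounts to an admissible cut, with trunk the component of the root, and a spanning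
subforest of the crown (`sum_edgeSet_rootComp`). Hence in `((φ ⋆ σ) * φ)(t)` the cuts contribute the
same products with `φ` in place of `-φ` on the root component, and the term of the total cut cancels
them (`convCK_starHTilde_signHom`). So `φ ⋆ σ` inverts `φ = φ ⋆ δ`; associativity of `*` makes the
inverse two-sided and unique. -/

namespace TreeHopf

namespace PTree

/-! ### Sums over admissible cuts and spanning subforests. -/

section Combinatorics

variable {A : Type*} [CommRing A]

theorem sum_admCut_dot {M : Type*} [AddCommMonoid M] (F : AdmCut dot → M) :
    ∑ w, F w = F () := by
  exact Fintype.sum_unique (ι := Unit) F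

theorem sum_admCut_graft {M : Type*} [AddCommMonoid M] (c t : PTree)
    (F : AdmCut (graft c t) → M) :
    ∑ w, F w = ∑ w : AdmCut t, F (none, w) + ∑ v : AdmCut c, ∑ w : AdmCut t, F (some v, w) := by
  exact (Fintype.sum_prod_type (α₁ := Option (AdmCut c)) (α₂ := AdmCut t) F).trans
    (Fintype.sum_option _)

theorem sum_edgeSet_dot {M : Type*} [AddCommMonoid M] (F : EdgeSet dot → M) :
    ∑ S, F S = F () := by
  exact Fintype.sum_unique (ι := Unit) F

theorem sum_edgeSet_graft {M : Type*} [AddCommMonoid M] (c t : PTree)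
    (F : EdgeSet (graft c t) → M) :
    ∑ S, F S = ∑ S : EdgeSet c, ∑ S' : EdgeSet t, F (true, S, S') +
      ∑ S : EdgeSet c, ∑ S' : EdgeSet t, F (false, S, S') := by
  refine (Fintype.sum_prod_type (α₁ := Bool) (α₂ := EdgeSet c × EdgeSet t) F).trans ?_
  rw [Fintype.sum_bool, Fintype.sum_prod_type, Fintype.sum_prod_type]

/-- Cutting twice: a cut whose crown is weighted by the convolution `z` of `x` and `y` is a cut
followed by a cut of the trunk. -/
theorem sum_admCut_conv {x y z : PTree → A}
    (hz : ∀ t, z t = x t + ∑ v : AdmCut t, ((crown t v).map x).prod * y (trunk t v))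
    (t : PTree) (f : PTree → A) :
    ∑ w : AdmCut t, ((crown t w).map z).prod * f (trunk t w) =
      ∑ w : AdmCut t, ((crown t w).map x).prod *
        ∑ v : AdmCut (trunk t w),
          ((crown (trunk t w) v).map y).prod * f (trunk (trunk t w) v) := by
  induction t generalizing f with
  | dot =>
    simp only [sum_admCut_dot]
    change _ = _ * ∑ v : AdmCut dot, ((crown dot v).map y).prod * f (trunk dot v)
    rw [sum_admCut_dot]
    simp [crown, trunk]
  | graft c t ihc iht =>
    simp only [sum_admCut_graft]
    have e1 : ∑ w : AdmCut t, ((crown (graft c t) (none, w)).map z).prod *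
        f (trunk (graft c t) (none, w)) =
        z c * ∑ w : AdmCut t, ((crown t w).map z).prod * f (trunk t w) := by
      simp only [crown, trunk, Multiset.map_cons, Multiset.prod_cons, Finset.mul_sum, mul_assoc]
    have e2 : ∑ v : AdmCut c, ∑ w : AdmCut t, ((crown (graft c t) (some v, w)).map z).prod *
        f (trunk (graft c t) (some v, w)) =
        ∑ v : AdmCut c, ((crown c v).map z).prod * ∑ w : AdmCut t, ((crown t w).map z).prod *
          f (graft (trunk c v) (trunk t w)) := by
      simp only [crown, trunk, Multiset.map_add, Multiset.prod_add, Finset.mul_sum, mul_assoc]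
    have e3 : ∑ w : AdmCut t, ((crown (graft c t) (none, w)).map x).prod *
        ∑ v : AdmCut (trunk (graft c t) (none, w)),
          ((crown (trunk (graft c t) (none, w)) v).map y).prod *
            f (trunk (trunk (graft c t) (none, w)) v) =
        x c * ∑ w : AdmCut t, ((crown t w).map x).prod *
        ∑ v : AdmCut (trunk t w),
          ((crown (trunk t w) v).map y).prod * f (trunk (trunk t w) v) := by
      simp only [crown, trunk, Multiset.map_cons, Multiset.prod_cons, Finset.mul_sum, mul_assoc]
      rfl
    -- If the first cut spares the new edge, the second may cut it (first summand) or spare it too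
    -- (second summand).
    have e4 : ∑ v : AdmCut c, ∑ w : AdmCut t, ((crown (graft c t) (some v, w)).map x).prod *
        ∑ u : AdmCut (trunk (graft c t) (some v, w)),
          ((crown (trunk (graft c t) (some v, w)) u).map y).prod *
            f (trunk (trunk (graft c t) (some v, w)) u) =
        (∑ v : AdmCut c, ((crown c v).map x).prod * y (trunk c v)) *
          (∑ w : AdmCut t, ((crown t w).map x).prod *
            ∑ v : AdmCut (trunk t w),
              ((crown (trunk t w) v).map y).prod * f (trunk (trunk t w) v)) +
        ∑ v : AdmCut c, ((crown c v).map x).prod *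
          ∑ v' : AdmCut (trunk c v), ((crown (trunk c v) v').map y).prod *
            ∑ w : AdmCut t, ((crown t w).map x).prod *
              ∑ w' : AdmCut (trunk t w), ((crown (trunk t w) w').map y).prod *
                f (graft (trunk (trunk c v) v') (trunk (trunk t w) w')) := by
      rw [Finset.sum_mul, ← Finset.sum_add_distrib]
      refine Finset.sum_congr rfl fun v _ => ?_
      rw [mul_assoc, ← mul_add, Finset.mul_sum (s := Finset.univ (α := AdmCut t)),
        Finset.sum_congr rfl fun v' _ => Finset.mul_sum (s := Finset.univ (α := AdmCut t)) ..,
        Finset.sum_comm, ← Finset.sum_add_distrib, Finset.mul_sum]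
      refine Finset.sum_congr rfl fun w _ => ?_
      change ((crown c v + crown t w).map x).prod *
        ∑ u : AdmCut (graft (trunk c v) (trunk t w)),
          ((crown (graft (trunk c v) (trunk t w)) u).map y).prod *
            f (trunk (graft (trunk c v) (trunk t w)) u) = _
      rw [sum_admCut_graft, Multiset.map_add, Multiset.prod_add, mul_assoc]
      congr 1
      rw [mul_add]
      congr 1
      · simp only [crown, trunk, Multiset.map_cons, Multiset.prod_cons, Finset.mul_sum]
        exact Finset.sum_congr rfl fun _ _ => by ring
      · simp only [crown, trunk, Multiset.map_add, Multiset.prod_add, Finset.mul_sum]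
        exact Finset.sum_congr rfl fun _ _ => Finset.sum_congr rfl fun _ _ => by ring
    -- The factor `z c` collects `x c`, from cutting the new edge at once, and the sum over cuts of
    -- `c`, from cutting it in the second round.
    rw [e1, e2, e3, e4, hz c, iht,
      ihc fun u => ∑ w : AdmCut t, ((crown t w).map z).prod * f (graft u (trunk t w)),
      add_mul, add_assoc]
    simp only [fun u => iht fun r => f (graft u r)]

/-- The empty cut is the only one with an empty crown. -/
theorem sum_admCut_counit (t : PTree) (f : PTree → A) :
    ∑ w : AdmCut t, ((crown t w).map fun _ => (0 : A)).prod * f (trunk t w) = f t := by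
  induction t generalizing f with
  | dot => rw [sum_admCut_dot]; simp [crown, trunk]
  | graft c t ihc iht =>
    simp only [sum_admCut_graft, crown, trunk, Multiset.map_cons, Multiset.prod_cons, zero_mul,
      Finset.sum_const_zero, zero_add, Multiset.map_add, Multiset.prod_add, mul_assoc]
    simp only [← Finset.mul_sum, fun u => iht fun r => f (graft u r), ihc fun u => f (graft u t)]

/-- A spanning subforest is an admissible cut, with trunk the component of the root, together with
a spanning subforest of the crown. -/
theorem sum_edgeSet_rootComp {p g : PTree → A}
    (hg : ∀ t, g t = ∑ S : EdgeSet t, ((comps t S).map p).prod) (t : PTree) (f : PTree → A) :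
    ∑ S : EdgeSet t, ((otherComps t S).map p).prod * f (rootComp t S) =
      ∑ w : AdmCut t, ((crown t w).map g).prod * f (trunk t w) := by
  induction t generalizing f with
  | dot => rw [sum_admCut_dot, sum_edgeSet_dot]; simp [crown, trunk, otherComps, rootComp]
  | graft c t ihc iht =>
    simp only [sum_admCut_graft, sum_edgeSet_graft, crown, trunk, rootComp, otherComps,
      Multiset.map_cons, Multiset.prod_cons, Multiset.map_add, Multiset.prod_add, mul_assoc]
    -- An edge outside the subforest is a cut edge, but it comes second in `sum_edgeSet_graft` and
    -- first in `sum_admCut_graft`.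
    rw [add_comm]
    congr 1
    · rw [← Finset.mul_sum, ← iht, hg c, Finset.sum_mul]
      simp only [comps, Multiset.map_cons, Multiset.prod_cons, Finset.mul_sum, mul_assoc]
    · simp only [← Finset.mul_sum, fun u => iht fun r => f (graft u r)]
      exact ihc fun u => ∑ w : AdmCut t, ((crown t w).map g).prod * f (graft u (trunk t w))

theorem merge_eq_dot {a b : PTree} : merge a b = dot ↔ a = dot ∧ b = dot := by
  cases a <;> simp [merge]

open Classical in
/-- The contraction is the one-vertex tree only for the subforest with all edges. -/
theorem sum_edgeSet_contract_eq_dot (t : PTree) (f : PTree → Multiset PTree → A) :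
    ∑ S : EdgeSet t, (if contract t S = dot then f (rootComp t S) (otherComps t S) else 0) =
      f t 0 := by
  induction t generalizing f with
  | dot => rw [sum_edgeSet_dot]; simp [contract, otherComps, rootComp]
  | graft c t ihc iht =>
    simp only [sum_edgeSet_graft, contract, rootComp, otherComps, merge_eq_dot, reduceCtorEq,
      if_false, Finset.sum_const_zero, add_zero, ite_and]
    have h := fun (S : EdgeSet c) => iht fun r o => f (graft (rootComp c S) r) (otherComps c S + o)
    have h' := ihc fun r o => f (graft r t) (o + 0)
    rw [← add_zero (0 : Multiset PTree), ← h']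
    refine Finset.sum_congr rfl fun S _ => ?_
    split_ifs
    · exact h S
    · simp

/-- `-1` to the number of vertices. -/
def sign : PTree → ℤ
  | dot => -1
  | graft c t => sign c * sign t

theorem sign_merge (a b : PTree) : sign (merge a b) = -(sign a * sign b) := by
  induction a with
  | dot => simp [merge, sign]
  | graft c t _ ih => simp only [merge, sign, ih]; ring

theorem Iso.sign_eq {t u : PTree} (h : Iso t u) : sign t = sign u := by
  induction h with
  | refl => rfl
  | symm _ ih => exact ih.symm
  | trans _ _ ih₁ ih₂ => exact ih₁.trans ih₂
  | congr _ _ ih₁ ih₂ => simp only [sign, ih₁, ih₂]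
  | swap => simp only [sign]; ring

theorem Iso.eq_dot_iff {t u : PTree} (h : Iso t u) : t = dot ↔ u = dot := by
  induction h with
  | refl => rfl
  | symm _ ih => exact ih.symm
  | trans _ _ ih₁ ih₂ => exact ih₁.trans ih₂
  | congr => simp
  | swap => simp

theorem mk_eq_dot {t : PTree} : RTree.mk t = RTree.dot ↔ t = dot :=
  ⟨fun h => (iso_of_mk_eq h).eq_dot_iff.2 rfl, fun h => h ▸ rfl⟩

/-- Contracting a subforest leaves one vertex for each component. -/
theorem sign_contract (t : PTree) (S : EdgeSet t) (p : PTree → A) :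
    ((comps t S).map p).prod * (sign (contract t S) : A) =
      ((comps t S).map fun c => -p c).prod := by
  -- Merging identifies two roots, so a contracted edge lowers both the number of vertices and the
  -- number of components by one.
  have hs : sign (contract t S) = (-1) ^ (comps t S).card := by
    induction t with
    | dot => simp [sign, contract, comps, otherComps]
    | graft c t ihc iht =>
      obtain ⟨b, S, S'⟩ := S
      have h1 := ihc S
      have h2 := iht S'
      simp only [comps, Multiset.card_cons] at h1 h2
      cases b <;>
        simp only [contract, comps, otherComps, sign, sign_merge, h1, h2, Multiset.card_cons,
          Multiset.card_add] <;> ring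
  rw [hs]
  induction comps t S using Multiset.induction_on with
  | empty => simp
  | cons a s ih =>
    simp only [Multiset.map_cons, Multiset.prod_cons, Multiset.card_cons, ← ih]
    push_cast
    ring

open Classical in
/-- The cut with trunk the one-vertex tree cuts all branches of the root. -/
theorem sum_admCut_trunk_eq_dot (t : PTree) :
    ∑ w : AdmCut t, ((crown t w).map fun c => (sign c : A)).prod *
      (if trunk t w = dot then 1 else 0) = -(sign t : A) := by
  induction t with
  | dot => rw [sum_admCut_dot]; simp [crown, trunk, sign]
  | graft c t ihc iht =>
    simp only [sum_admCut_graft, crown, trunk, reduceCtorEq, if_false, mul_zero,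
      Finset.sum_const_zero, add_zero, Multiset.map_cons, Multiset.prod_cons, mul_assoc,
      ← Finset.mul_sum, sign, Int.cast_mul]
    rw [← mul_neg, ← iht]
    rfl

end Combinatorics

end PTree

end TreeHopf

namespace TreeHopf

/-- `-1` to the number of vertices of a rooted tree. -/
def RTree.sign : RTree → ℤ := Quotient.lift PTree.sign fun _ _ h => PTree.Iso.sign_eq h

theorem RTree.exists_mk (t : RTree) : ∃ u, RTree.mk u = t := Quotient.exists_rep t

noncomputable section

variable {k : Type*} [Field k]

/-! ### Convolution of algebra morphisms -/

section Convolution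

variable {A B : Type*} [CommRing A] [Algebra k A] [CommRing B] [Algebra k B]

/-- The convolution of algebra morphisms from the Connes-Kreimer algebra. -/
def convHom (x y : HCK k →ₐ[k] A) : HCK k →ₐ[k] A :=
  (Algebra.TensorProduct.productMap x y).comp coprodCK

/-- The value of an algebra morphism on the class of a planar tree. -/
def valTree (x : HCK k →ₐ[k] A) (t : PTree) : A := x (HCK.tree (RTree.mk t))

theorem hom_ext {x y : HCK k →ₐ[k] A} (h : ∀ t, valTree x t = valTree y t) : x = y := by
  refine MvPolynomial.algHom_ext fun t => ?_
  obtain ⟨u, rfl⟩ := t.exists_mk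
  exact h u

theorem valTree_aeval (v : RTree → A) (t : PTree) :
    valTree (MvPolynomial.aeval v : HCK k →ₐ[k] A) t = v (RTree.mk t) :=
  MvPolynomial.aeval_X v _

theorem coprodCK_tree (t : PTree) :
    coprodCK (k := k) (HCK.tree (RTree.mk t) : HCK k) = HCK.tree (RTree.mk t) ⊗ₜ[k] 1 + ∑ w : t.AdmCut,
      (((t.crown w).map fun c => HCK.tree (RTree.mk c)).prod ⊗ₜ[k]
        HCK.tree (RTree.mk (t.trunk w))) :=
  MvPolynomial.aeval_X _ _

theorem valTree_convHom (x y : HCK k →ₐ[k] A) (t : PTree) :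
    valTree (convHom x y) t = valTree x t +
      ∑ w : t.AdmCut, ((t.crown w).map (valTree x)).prod * valTree y (t.trunk w) := by
  simp only [valTree, convHom, AlgHom.comp_apply, coprodCK_tree, map_add, map_sum,
    Algebra.TensorProduct.productMap_apply_tmul, map_one, mul_one, map_multiset_prod,
    Multiset.map_map]
  rfl

/-- On trees this is cutting twice, `sum_admCut_conv`; the total cut contributes the remaining
terms. -/
theorem convHom_assoc (x y z : HCK k →ₐ[k] A) :
    convHom (convHom x y) z = convHom x (convHom y z) := by
  refine hom_ext fun t => ?_
  rw [valTree_convHom, valTree_convHom x (convHom y z),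
    PTree.sum_admCut_conv (valTree_convHom x y), valTree_convHom x y, add_assoc,
    ← Finset.sum_add_distrib]
  simp only [valTree_convHom y z, mul_add]

theorem comp_convHom (h : A →ₐ[k] B) (x y : HCK k →ₐ[k] A) :
    h.comp (convHom x y) = convHom (h.comp x) (h.comp y) := by
  rw [convHom, convHom, ← AlgHom.comp_assoc]
  congr 1
  exact Algebra.TensorProduct.ext' fun a b => by simp

/-- The coproduct is the universal convolution, which turns associativity for morphisms into
coassociativity. -/
theorem coprodCK_eq_convHom : (coprodCK : HCK k →ₐ[k] HCK k ⊗[k] HCK k) =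
    convHom Algebra.TensorProduct.includeLeft Algebra.TensorProduct.includeRight := by
  rw [convHom]
  have : Algebra.TensorProduct.productMap Algebra.TensorProduct.includeLeft
      Algebra.TensorProduct.includeRight = AlgHom.id k (HCK k ⊗[k] HCK k) :=
    Algebra.TensorProduct.ext' fun a b => by simp
  rw [this, AlgHom.id_comp]

/-- Both sides are the convolution of the three inclusions into the triple tensor product.
Coassociativity is needed because convolution inverses are arbitrary linear forms, beyond the reach
of `convHom_assoc`. -/
theorem coprodCK_coassoc :
    (Algebra.TensorProduct.assoc k k k (HCK k) (HCK k) (HCK k)).toAlgHom.comp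
      ((Algebra.TensorProduct.map (coprodCK (k := k)) (AlgHom.id k (HCK k))).comp
        (coprodCK (k := k))) =
    (Algebra.TensorProduct.map (AlgHom.id k (HCK k)) (coprodCK (k := k))).comp
      (coprodCK (k := k)) := by
  let i : HCK k →ₐ[k] HCK k ⊗[k] (HCK k ⊗[k] HCK k) := Algebra.TensorProduct.includeLeft
  let r : HCK k ⊗[k] HCK k →ₐ[k] HCK k ⊗[k] (HCK k ⊗[k] HCK k) :=
    Algebra.TensorProduct.includeRight
  let j : HCK k →ₐ[k] HCK k ⊗[k] (HCK k ⊗[k] HCK k) :=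
    r.comp Algebra.TensorProduct.includeLeft
  let l : HCK k →ₐ[k] HCK k ⊗[k] (HCK k ⊗[k] HCK k) :=
    r.comp Algebra.TensorProduct.includeRight
  trans convHom (k := k) (A := HCK k ⊗[k] (HCK k ⊗[k] HCK k)) (convHom i j) l
  · rw [convHom, ← AlgHom.comp_assoc]
    congr 1
    refine Algebra.TensorProduct.ext' fun a b => ?_
    let q : HCK k ⊗[k] HCK k →ₐ[k] HCK k ⊗[k] (HCK k ⊗[k] HCK k) :=
      (Algebra.TensorProduct.assoc k k k _ _ _).toAlgHom.comp
        (Algebra.TensorProduct.includeLeft (S := k) (B := HCK k))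
    have h := comp_convHom (k := k) (A := HCK k ⊗[k] HCK k)
      (B := HCK k ⊗[k] (HCK k ⊗[k] HCK k)) q
      Algebra.TensorProduct.includeLeft Algebra.TensorProduct.includeRight
    rw [← coprodCK_eq_convHom] at h
    have hi : q.comp Algebra.TensorProduct.includeLeft = i := AlgHom.ext fun x => by
      simp [q, i, Algebra.TensorProduct.one_def]
    have hj : q.comp Algebra.TensorProduct.includeRight = j := AlgHom.ext fun x => by
      simp [q, j, r]
    rw [hi, hj] at h
    rw [Algebra.TensorProduct.productMap_apply_tmul, ← h]
    simp only [AlgHom.comp_apply, Algebra.TensorProduct.map_tmul, AlgHom.id_apply]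
    -- `Δ(a) ⊗ b` is split as `(Δ(a) ⊗ 1)(1 ⊗ b)`, whose factors are the images under `q` and `l`.
    rw [← mul_one (coprodCK (k := k) a), ← one_mul b, ← Algebra.TensorProduct.tmul_mul_tmul,
      map_mul]
    simp only [mul_one, one_mul]
    rfl
  · rw [convHom_assoc, convHom]
    congr 1
    refine Algebra.TensorProduct.ext' fun a b => ?_
    rw [← comp_convHom, ← coprodCK_eq_convHom]
    simp [i, r]

end Convolution

/-! ### Convolution of linear forms -/

theorem convCK_assoc (f g h : HCK k →ₗ[k] k) :
    convCK (convCK f g) h = convCK f (convCK g h) := by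
  let T : HCK k ⊗[k] (HCK k ⊗[k] HCK k) →ₗ[k] k :=
    LinearMap.mul' k k ∘ₗ TensorProduct.map f (LinearMap.mul' k k ∘ₗ TensorProduct.map g h)
  refine LinearMap.ext fun x => ?_
  change LinearMap.mul' k k (TensorProduct.map (convCK f g) h (coprodCK (k := k) x)) =
    LinearMap.mul' k k (TensorProduct.map f (convCK g h) (coprodCK (k := k) x))
  trans T (Algebra.TensorProduct.assoc k k k (HCK k) (HCK k) (HCK k)
      (Algebra.TensorProduct.map coprodCK (AlgHom.id k (HCK k)) (coprodCK (k := k) x)))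
  · induction coprodCK (k := k) x using TensorProduct.induction_on with
    | zero => simp
    | add u v hu hv => simp only [map_add, hu, hv]
    | tmul a b =>
      rw [Algebra.TensorProduct.map_tmul, TensorProduct.map_tmul]
      change (LinearMap.mul' k k (TensorProduct.map f g (coprodCK (k := k) a))) * h b = _
      induction coprodCK (k := k) a using TensorProduct.induction_on with
      | zero => simp
      | add u v hu hv => simp only [map_add, add_mul, hu, hv, TensorProduct.add_tmul]
      | tmul c d => simp [T, mul_assoc]
  · have := DFunLike.congr_fun (coprodCK_coassoc (k := k)) x
    refine (congrArg T this).trans ?_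
    change T (Algebra.TensorProduct.map (AlgHom.id k (HCK k)) coprodCK (coprodCK (k := k) x)) = _
    induction coprodCK (k := k) x using TensorProduct.induction_on with
    | zero => simp
    | add u v hu hv => simp only [map_add, hu, hv]
    | tmul a b => rfl

theorem convCK_toLinearMap (x y : HCK k →ₐ[k] k) :
    convCK x.toLinearMap y.toLinearMap = (convHom x y).toLinearMap := by
  refine LinearMap.ext fun a => ?_
  change LinearMap.mul' k k (TensorProduct.map _ _ (coprodCK (k := k) a)) =
    Algebra.TensorProduct.productMap x y (coprodCK (k := k) a)
  induction coprodCK (k := k) a using TensorProduct.induction_on with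
  | zero => simp
  | add u v hu hv => simp only [map_add, hu, hv]
  | tmul c d => simp

/-- The counit as an algebra morphism. -/
def counitHom : HCK k →ₐ[k] k := MvPolynomial.aeval fun _ => 0

theorem counitHom_toLinearMap : (counitHom : HCK k →ₐ[k] k).toLinearMap = counitCK := by
  refine LinearMap.ext fun x => ?_
  change MvPolynomial.aeval (fun _ => (0 : k)) x = MvPolynomial.coeff 0 x
  have h : (fun _ => (0 : k)) = (0 : RTree → k) := rfl
  rw [h, MvPolynomial.aeval_zero]
  rfl

theorem valTree_counitHom (t : PTree) : valTree (counitHom : HCK k →ₐ[k] k) t = 0 :=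
  valTree_aeval _ t

/-- The identity `(ε ⊗ id) ∘ Δ = id` is one of algebra morphisms, so it is checked on trees;
applying `f` then covers every linear form. -/
theorem convCK_counit_left (f : HCK k →ₗ[k] k) : convCK counitCK f = f := by
  have h : convHom ((Algebra.ofId k (HCK k)).comp counitHom) (AlgHom.id k (HCK k)) =
      AlgHom.id k (HCK k) := by
    refine hom_ext fun t => ?_
    have : valTree ((Algebra.ofId k (HCK k)).comp counitHom) = fun _ => 0 := by
      ext1 t
      exact (congrArg (Algebra.ofId k (HCK k)) (valTree_counitHom t)).trans (map_zero _)
    rw [valTree_convHom, this, PTree.sum_admCut_counit, zero_add]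
  refine LinearMap.ext fun x => ?_
  conv_rhs => rw [← AlgHom.id_apply (R := k) x, ← h]
  rw [← counitHom_toLinearMap]
  change LinearMap.mul' k k (TensorProduct.map _ _ (coprodCK (k := k) x)) =
    f (Algebra.TensorProduct.productMap _ _ (coprodCK (k := k) x))
  induction coprodCK (k := k) x using TensorProduct.induction_on with
  | zero => simp
  | add u v hu hv => simp only [map_add, hu, hv]
  | tmul c d =>
    simp only [TensorProduct.map_tmul, Algebra.TensorProduct.productMap_apply_tmul,
      AlgHom.comp_apply, Algebra.ofId_apply, ← Algebra.smul_def, map_smul]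
    rfl

theorem convCK_counit_right (f : HCK k →ₗ[k] k) : convCK f counitCK = f := by
  have h : convHom (AlgHom.id k (HCK k)) ((Algebra.ofId k (HCK k)).comp counitHom) =
      AlgHom.id k (HCK k) := by
    refine hom_ext fun t => ?_
    have : valTree ((Algebra.ofId k (HCK k)).comp counitHom) = fun _ => 0 := by
      ext1 t
      exact (congrArg (Algebra.ofId k (HCK k)) (valTree_counitHom t)).trans (map_zero _)
    rw [valTree_convHom, this]
    simp
  refine LinearMap.ext fun x => ?_
  conv_rhs => rw [← AlgHom.id_apply (R := k) x, ← h]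
  rw [← counitHom_toLinearMap]
  change LinearMap.mul' k k (TensorProduct.map _ _ (coprodCK (k := k) x)) =
    f (Algebra.TensorProduct.productMap _ _ (coprodCK (k := k) x))
  induction coprodCK (k := k) x using TensorProduct.induction_on with
  | zero => simp
  | add u v hu hv => simp only [map_add, hu, hv]
  | tmul c d =>
    rw [Algebra.TensorProduct.productMap_apply_tmul, mul_comm (AlgHom.id k (HCK k) c)]
    simp only [TensorProduct.map_tmul, LinearMap.mul'_apply,
      AlgHom.comp_apply, Algebra.ofId_apply, ← Algebra.smul_def, map_smul]
    exact mul_comm _ _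

/-- The monoid argument `c = (g * b) * c = g * (b * c) = g`; a left inverse `g` is enough. -/
theorem IsConvInv.unique {b c : HCK k →ₗ[k] k} (h : IsConvInv b c) {g : HCK k →ₗ[k] k}
    (hg : convCK g b = counitCK) : c = g := by
  rw [← convCK_counit_left c, ← hg, convCK_assoc, h.1, convCK_counit_right]

/-! ### Characters -/

theorem isCharacter_toLinearMap {A : Type*} [CommRing A] [Algebra k A] (x : A →ₐ[k] k) :
    IsCharacter x.toLinearMap :=
  ⟨map_one x, map_mul x⟩

theorem IsCharacter.exists_algHom {A : Type*} [CommRing A] [Algebra k A] {f : A →ₗ[k] k}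
    (h : IsCharacter f) : ∃ x : A →ₐ[k] k, x.toLinearMap = f :=
  ⟨AlgHom.ofLinearMap f h.1 h.2, rfl⟩

theorem isCharacter_ext {f g : HCK k →ₗ[k] k} (hf : IsCharacter f) (hg : IsCharacter g)
    (h : ∀ t, f (HCK.tree t) = g (HCK.tree t)) : f = g := by
  obtain ⟨x, rfl⟩ := hf.exists_algHom
  obtain ⟨y, rfl⟩ := hg.exists_algHom
  exact congrArg _ (hom_ext fun t => h _)

theorem IsInfChar.map_one {f : HCK k →ₗ[k] k} (hf : IsInfChar f) : f 1 = 0 := by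
  have h := hf 1 1
  have h1 : counitCK (1 : HCK k) = 1 := by
    rw [← counitHom_toLinearMap]
    exact _root_.map_one counitHom
  simpa [h1] using h

theorem isInfChar_ext {f g : HCK k →ₗ[k] k} (hf : IsInfChar f) (hg : IsInfChar g)
    (h : ∀ t, f (HCK.tree t) = g (HCK.tree t)) : f = g := by
  refine LinearMap.ext fun p => ?_
  induction p using MvPolynomial.induction_on with
  | C a => rw [← mul_one (MvPolynomial.C a), ← MvPolynomial.smul_eq_C_mul, map_smul, map_smul,
      hf.map_one, hg.map_one]
  | add p q hp hq => rw [map_add, map_add, hp, hq]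
  | mul_X p t hp =>
    have ht : f (MvPolynomial.X t) = g (MvPolynomial.X t) := h t
    rw [hf, hg, hp, ht]

/-! ### The action of characters -/

/-- The action on algebra morphisms. -/
def starHom (φ : HTilde k →ₐ[k] k) (b : HCK k →ₐ[k] k) : HCK k →ₐ[k] k :=
  (Algebra.TensorProduct.productMap φ b).comp coactHTilde

theorem starHTilde_toLinearMap (φ : HTilde k →ₐ[k] k) (b : HCK k →ₐ[k] k) :
    starHTilde φ.toLinearMap b.toLinearMap = (starHom φ b).toLinearMap := by
  refine LinearMap.ext fun a => ?_
  change LinearMap.mul' k k (TensorProduct.map _ _ (coactHTilde (k := k) a)) =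
    Algebra.TensorProduct.productMap φ b (coactHTilde (k := k) a)
  induction coactHTilde (k := k) a using TensorProduct.induction_on with
  | zero => simp
  | add u v hu hv => simp only [map_add, hu, hv]
  | tmul c d => simp

theorem starHTilde_tree (φ : HTilde k →ₐ[k] k) (b : HCK k →ₗ[k] k) (t : PTree) :
    starHTilde φ.toLinearMap b (HCK.tree (RTree.mk t)) = ∑ S : t.EdgeSet,
      ((t.comps S).map (valTree φ)).prod * b (HCK.tree (RTree.mk (t.contract S))) := by
  have h : coactHTilde (k := k) (HCK.tree (RTree.mk t) : HCK k) = ∑ S : t.EdgeSet,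
      (((t.comps S).map fun c => HTilde.tree (RTree.mk c)).prod ⊗ₜ[k]
        HCK.tree (RTree.mk (t.contract S))) := MvPolynomial.aeval_X _ _
  change LinearMap.mul' k k (TensorProduct.map _ _ (coactHTilde (k := k) _)) = _
  simp only [h, map_sum, TensorProduct.map_tmul, LinearMap.mul'_apply,
    AlgHom.toLinearMap_apply, map_multiset_prod, Multiset.map_map]
  rfl

open Classical in
-- Only the full subforest survives. No multiplicativity of `b` is used, so the lemma serves `δ` and
-- `δ_•` alike.
theorem starHTilde_tree_of_dot (φ : HTilde k →ₐ[k] k) {b : HCK k →ₗ[k] k}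
    (hb : ∀ t, b (HCK.tree t) = if t = RTree.dot then 1 else 0) (t : RTree) :
    starHTilde φ.toLinearMap b (HCK.tree t) = φ (HTilde.tree t) := by
  obtain ⟨u, rfl⟩ := t.exists_mk
  rw [starHTilde_tree]
  simp only [hb, PTree.mk_eq_dot, mul_ite, mul_one, mul_zero]
  refine (PTree.sum_edgeSet_contract_eq_dot u
    fun r o => ((r ::ₘ o).map (valTree φ)).prod).trans ?_
  simp [valTree]
  rfl

open Classical in
theorem deltaChar_tree (t : RTree) :
    deltaChar k (HCK.tree t) = if t = RTree.dot then 1 else 0 :=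
  MvPolynomial.aeval_X _ _

open Classical in
theorem deltaDot_tree (t : RTree) :
    deltaDot k (HCK.tree t) = if t = RTree.dot then 1 else 0 := by
  change MvPolynomial.coeff _ (MvPolynomial.X t) = _
  rw [MvPolynomial.coeff_X]
  simp [Finsupp.single_left_inj]

theorem isInfChar_deltaDot : IsInfChar (deltaDot k) := by
  intro x y
  change MvPolynomial.coeff _ (x * y) = MvPolynomial.coeff _ x * MvPolynomial.coeff _ y +
    MvPolynomial.coeff _ x * MvPolynomial.coeff _ y
  classical
  rw [MvPolynomial.coeff_mul, Finsupp.antidiagonal_single]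
  simp [Finset.Nat.antidiagonal_succ, add_comm]

/-- A contraction of a tree is again a tree, where the counit vanishes. This keeps the Leibniz rule
relative to `ε` under the action. -/
theorem starHTilde_counit (φ : HTilde k →ₐ[k] k) :
    starHTilde φ.toLinearMap counitCK = counitCK := by
  rw [← counitHom_toLinearMap, starHTilde_toLinearMap]
  refine congrArg _ (hom_ext fun t => ?_)
  refine (starHTilde_toLinearMap φ counitHom ▸ starHTilde_tree φ _ t :
    (starHom φ counitHom).toLinearMap _ = _).trans ?_
  rw [valTree_counitHom]
  exact Finset.sum_eq_zero fun S _ => mul_eq_zero_of_right _ (valTree_counitHom _)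

theorem isInfChar_starHTilde (φ : HTilde k →ₐ[k] k) {b : HCK k →ₗ[k] k} (hb : IsInfChar b) :
    IsInfChar (starHTilde φ.toLinearMap b) := by
  let F (f : HCK k →ₗ[k] k) := LinearMap.mul' k k ∘ₗ TensorProduct.map φ.toLinearMap f
  -- Since `φ` is multiplicative, `φ ⊗ b` inherits a Leibniz rule, with `φ ⊗ ε` in the role of the
  -- counit.
  have key (u v : HTilde k ⊗[k] HCK k) :
      F b (u * v) = F b u * F counitCK v + F counitCK u * F b v := by
    induction u using TensorProduct.induction_on with
    | zero => simp
    | add u u' hu hu' => rw [add_mul, map_add, hu, hu', map_add, map_add]; ring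
    | tmul c d =>
      induction v using TensorProduct.induction_on with
      | zero => simp
      | add v v' hv hv' => rw [mul_add, map_add, hv, hv', map_add, map_add]; ring
      | tmul c' d' =>
        simp only [F, Algebra.TensorProduct.tmul_mul_tmul, LinearMap.comp_apply,
          TensorProduct.map_tmul, LinearMap.mul'_apply, AlgHom.toLinearMap_apply, map_mul, hb d d']
        ring
  intro x y
  nth_rw 1 [← starHTilde_counit φ]
  nth_rw 2 [← starHTilde_counit φ]
  have := key (coactHTilde (k := k) x) (coactHTilde (k := k) y)
  rw [← map_mul] at this
  exact this

theorem isCharacter_deltaChar : IsCharacter (deltaChar k) := isCharacter_toLinearMap _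

theorem isCharacter_starHTilde {φ : HTilde k →ₗ[k] k} (hφ : IsCharacter φ)
    {b : HCK k →ₗ[k] k} (hb : IsCharacter b) : IsCharacter (starHTilde φ b) := by
  obtain ⟨x, rfl⟩ := hφ.exists_algHom
  obtain ⟨y, rfl⟩ := hb.exists_algHom
  rw [starHTilde_toLinearMap]
  exact isCharacter_toLinearMap _

theorem starHTilde_deltaChar_tree {φ : HTilde k →ₗ[k] k} (hφ : IsCharacter φ) (t : RTree) :
    starHTilde φ (deltaChar k) (HCK.tree t) = φ (HTilde.tree t) := by
  obtain ⟨x, rfl⟩ := hφ.exists_algHom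
  exact starHTilde_tree_of_dot x deltaChar_tree t

theorem starHTilde_deltaDot_tree {φ : HTilde k →ₗ[k] k} (hφ : IsCharacter φ) (t : RTree) :
    starHTilde φ (deltaDot k) (HCK.tree t) = φ (HTilde.tree t) := by
  obtain ⟨x, rfl⟩ := hφ.exists_algHom
  exact starHTilde_tree_of_dot x deltaDot_tree t

theorem isInfChar_starHTilde_deltaDot {φ : HTilde k →ₗ[k] k} (hφ : IsCharacter φ) :
    IsInfChar (starHTilde φ (deltaDot k)) := by
  obtain ⟨x, rfl⟩ := hφ.exists_algHom
  exact isInfChar_starHTilde x isInfChar_deltaDot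

theorem starHTilde_deltaChar {φ : HTilde k →ₗ[k] k} (hφ : IsCharacter φ) :
    starHTilde φ (deltaChar k) = φ :=
  isCharacter_ext (isCharacter_starHTilde hφ isCharacter_deltaChar) hφ
    (starHTilde_deltaChar_tree hφ)

/-! ### Convolution inverses -/

variable (k) in
/-- The character with value `-1` to the number of vertices on each tree. -/
def signHom : HCK k →ₐ[k] k := MvPolynomial.aeval fun t => (t.sign : k)

theorem valTree_signHom (t : PTree) : valTree (signHom k) t = (t.sign : k) :=
  valTree_aeval _ t

/-- Besides the total cut, only the cut of all root branches counts; its crown has one vertex fewer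
than `t`, hence the opposite sign. -/
theorem convCK_signHom_deltaChar : convCK (signHom k).toLinearMap (deltaChar k) = counitCK := by
  classical
  rw [deltaChar, convCK_toLinearMap, ← counitHom_toLinearMap]
  refine congrArg _ (hom_ext fun t => ?_)
  rw [valTree_convHom, valTree_counitHom]
  have h := PTree.sum_admCut_trunk_eq_dot (A := k) t
  have hs : valTree (signHom k) = fun c => (c.sign : k) := funext valTree_signHom
  simp only [valTree_aeval, PTree.mk_eq_dot, hs]
  exact (congrArg _ h).trans (add_neg_cancel _)

theorem convCK_starHTilde_signHom (φ : HTilde k →ₐ[k] k) :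
    convCK (starHTilde φ.toLinearMap (signHom k).toLinearMap) φ.toLinearMap = counitCK := by
  have hg (t : PTree) : valTree (starHom φ (signHom k)) t =
      ∑ S : t.EdgeSet, ((t.comps S).map fun c => -valTree φ c).prod := by
    refine (starHTilde_toLinearMap φ (signHom k) ▸ starHTilde_tree φ _ t :
      (starHom φ (signHom k)).toLinearMap _ = _).trans ?_
    refine Finset.sum_congr rfl fun S _ => ?_
    rw [← PTree.sign_contract, ← valTree_signHom]
    rfl
  rw [starHTilde_toLinearMap, convCK_toLinearMap, ← counitHom_toLinearMap]
  refine congrArg _ (hom_ext fun t => ?_)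
  -- Both sums now run over the same subforests, and their terms differ only by the sign on the root
  -- component.
  rw [valTree_convHom, valTree_counitHom, ← PTree.sum_edgeSet_rootComp hg, hg,
    ← Finset.sum_add_distrib]
  refine Finset.sum_eq_zero fun S _ => ?_
  rw [PTree.comps, Multiset.map_cons, Multiset.prod_cons]
  ring

theorem isConvInv_starHTilde_signHom {b : HCK k →ₗ[k] k} (hb : IsCharacter b) :
    IsConvInv b (starHTilde b (signHom k).toLinearMap) := by
  have left {b : HCK k →ₗ[k] k} (hb : IsCharacter b) :
      convCK (starHTilde b (signHom k).toLinearMap) b = counitCK := by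
    obtain ⟨φ, rfl⟩ := hb.exists_algHom
    exact convCK_starHTilde_signHom φ
  have hg := isCharacter_starHTilde hb (isCharacter_toLinearMap (signHom k))
  refine ⟨?_, left hb⟩
  -- With `b' = b ⋆ σ`, a character, `b' ⋆ σ` is a left inverse of `b'` and `b` is a right inverse,
  -- so they coincide and `b * b' = ε`.
  have h : starHTilde (starHTilde b (signHom k).toLinearMap) (signHom k).toLinearMap = b := by
    rw [← convCK_counit_right (starHTilde (starHTilde b _) _), ← left hb, ← convCK_assoc,
      left hg, convCK_counit_left]
  have h' := left hg
  rwa [h] at h'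

/-- By uniqueness `deltaInv` is `σ`, and both sides are the inverse of `φ ⋆ δ = φ`. -/
theorem convInv_eq_starHTilde {φ bInv deltaInv : HCK k →ₗ[k] k} (hφ : IsCharacter φ)
    (hb : IsConvInv (starHTilde φ (deltaChar k)) bInv) (hd : IsConvInv (deltaChar k) deltaInv) :
    bInv = starHTilde φ deltaInv := by
  rw [starHTilde_deltaChar hφ] at hb
  rw [hd.unique convCK_signHom_deltaChar]
  exact hb.unique (isConvInv_starHTilde_signHom hφ).2

/-! ### Reduction of `H` to `H̃` -/

/-- The projection `H̃ → H` that identifies the one-vertex tree with the unit. -/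
def projH : HTilde k →ₐ[k] H k := MvPolynomial.aeval H.tree

theorem projH_tree (t : RTree) : projH (HTilde.tree t : HTilde k) = H.tree t :=
  MvPolynomial.aeval_X _ _

theorem coactH_eq : (coactH : HCK k →ₐ[k] _) =
    (Algebra.TensorProduct.map projH (AlgHom.id k (HCK k))).comp coactHTilde := by
  refine MvPolynomial.algHom_ext fun t => ?_
  obtain ⟨u, rfl⟩ := t.exists_mk
  rw [AlgHom.comp_apply, coactH, coactHTilde, MvPolynomial.aeval_X, MvPolynomial.aeval_X]
  change ∑ S : u.EdgeSet, _ = Algebra.TensorProduct.map projH _ (∑ S : u.EdgeSet, _)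
  simp only [map_sum, Algebra.TensorProduct.map_tmul, map_multiset_prod, Multiset.map_map,
    Function.comp_def, projH_tree, AlgHom.id_apply]

/-- One-vertex components are sent to the unit by `projH`, so every statement on `H` becomes one on
`H̃`. -/
theorem starH_eq (φ : H k →ₗ[k] k) (b : HCK k →ₗ[k] k) :
    starH φ b = starHTilde (φ ∘ₗ projH.toLinearMap) b := by
  refine LinearMap.ext fun x => ?_
  change LinearMap.mul' k k (TensorProduct.map φ b (coactH (k := k) x)) =
    LinearMap.mul' k k (TensorProduct.map _ b (coactHTilde (k := k) x))
  rw [coactH_eq, AlgHom.comp_apply]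
  induction coactHTilde (k := k) x using TensorProduct.induction_on with
  | zero => simp
  | add u v hu hv => simp only [map_add, hu, hv]
  | tmul c d => rfl

theorem isCharacter_comp_projH {φ : H k →ₗ[k] k} (hφ : IsCharacter φ) :
    IsCharacter (φ ∘ₗ projH.toLinearMap) := by
  obtain ⟨x, rfl⟩ := hφ.exists_algHom
  exact isCharacter_toLinearMap (x.comp projH)

theorem H_tree_dot : (H.tree RTree.dot : H k) = 1 := dif_pos rfl

theorem isCharacter_ext_H {f g : H k →ₗ[k] k} (hf : IsCharacter f) (hg : IsCharacter g)
    (h : ∀ t, f (H.tree t) = g (H.tree t)) : f = g := by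
  obtain ⟨x, rfl⟩ := hf.exists_algHom
  obtain ⟨y, rfl⟩ := hg.exists_algHom
  refine congrArg _ (MvPolynomial.algHom_ext fun t => ?_)
  have := h t
  rwa [H.tree, dif_neg t.2] at this

theorem exists_isCharacter_H {v : RTree → k} (hv : v RTree.dot = 1) :
    ∃ φ : H k →ₗ[k] k, IsCharacter φ ∧ ∀ t, φ (H.tree t) = v t := by
  refine ⟨(MvPolynomial.aeval fun t : {t : RTree // t ≠ RTree.dot} => v t).toLinearMap,
    isCharacter_toLinearMap _, fun t => ?_⟩
  by_cases h : t = RTree.dot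
  · rw [h, H_tree_dot, hv]
    exact map_one (MvPolynomial.aeval fun t : {t : RTree // t ≠ RTree.dot} => v t)
  · rw [H.tree, dif_neg h]
    exact MvPolynomial.aeval_X _ _

theorem exists_isCharacter_HTilde (v : RTree → k) :
    ∃ φ : HTilde k →ₗ[k] k, IsCharacter φ ∧ ∀ t, φ (HTilde.tree t) = v t :=
  ⟨(MvPolynomial.aeval v).toLinearMap, isCharacter_toLinearMap _,
    fun _ => MvPolynomial.aeval_X _ _⟩

end

end TreeHopf

/-! ### The four bijections and the formula for inverses. -/

open TreeHopf

theorem mainTheorem4 (k : Type*) [Field k] [CharZero k] :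
    -- characters of the Hopf algebra `H`, infinitesimal characters of `H_CK`
    ((∀ φ : TreeHopf.H k →ₗ[k] k, TreeHopf.IsCharacter φ →
        ∀ ξ : TreeHopf.HCK k →ₗ[k] k, ξ = TreeHopf.starH φ (TreeHopf.deltaDot k) ↔
          TreeHopf.IsInfChar ξ ∧
            ∀ t : TreeHopf.RTree, ξ (TreeHopf.HCK.tree t) = φ (TreeHopf.H.tree t)) ∧
      Set.BijOn (fun φ : TreeHopf.H k →ₗ[k] k => TreeHopf.starH φ (TreeHopf.deltaDot k))
        {φ | TreeHopf.IsCharacter φ}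
        {ξ | TreeHopf.IsInfChar ξ ∧ ξ (TreeHopf.HCK.tree TreeHopf.RTree.dot) = 1}) ∧
    -- characters of the Hopf algebra `H`, characters of `H_CK`
    ((∀ φ : TreeHopf.H k →ₗ[k] k, TreeHopf.IsCharacter φ →
        ∀ b : TreeHopf.HCK k →ₗ[k] k, b = TreeHopf.starH φ (TreeHopf.deltaChar k) ↔
          TreeHopf.IsCharacter b ∧
            ∀ t : TreeHopf.RTree, b (TreeHopf.HCK.tree t) = φ (TreeHopf.H.tree t)) ∧
      Set.BijOn (fun φ : TreeHopf.H k →ₗ[k] k => TreeHopf.starH φ (TreeHopf.deltaChar k))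
        {φ | TreeHopf.IsCharacter φ}
        {b | TreeHopf.IsCharacter b ∧ b (TreeHopf.HCK.tree TreeHopf.RTree.dot) = 1}) ∧
    -- characters of the bialgebra `H̃`, infinitesimal characters of `H_CK`
    ((∀ φ : TreeHopf.HTilde k →ₗ[k] k, TreeHopf.IsCharacter φ →
        ∀ ξ : TreeHopf.HCK k →ₗ[k] k, ξ = TreeHopf.starHTilde φ (TreeHopf.deltaDot k) ↔
          TreeHopf.IsInfChar ξ ∧
            ∀ t : TreeHopf.RTree, ξ (TreeHopf.HCK.tree t) = φ (TreeHopf.HTilde.tree t)) ∧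
      Set.BijOn (fun φ : TreeHopf.HTilde k →ₗ[k] k => TreeHopf.starHTilde φ (TreeHopf.deltaDot k))
        {φ | TreeHopf.IsCharacter φ} {ξ | TreeHopf.IsInfChar ξ}) ∧
    -- characters of the bialgebra `H̃`, characters of `H_CK`
    ((∀ φ : TreeHopf.HTilde k →ₗ[k] k, TreeHopf.IsCharacter φ →
        ∀ b : TreeHopf.HCK k →ₗ[k] k, b = TreeHopf.starHTilde φ (TreeHopf.deltaChar k) ↔
          TreeHopf.IsCharacter b ∧
            ∀ t : TreeHopf.RTree, b (TreeHopf.HCK.tree t) = φ (TreeHopf.HTilde.tree t)) ∧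
      Set.BijOn (fun φ : TreeHopf.HTilde k →ₗ[k] k => TreeHopf.starHTilde φ (TreeHopf.deltaChar k))
        {φ | TreeHopf.IsCharacter φ} {b | TreeHopf.IsCharacter b}) ∧
    -- characters of `H_CK`, in particular `δ`, have a unique convolution inverse
    TreeHopf.IsCharacter (TreeHopf.deltaChar k) ∧
    (∀ b : TreeHopf.HCK k →ₗ[k] k, TreeHopf.IsCharacter b →
      ∃! c : TreeHopf.HCK k →ₗ[k] k, TreeHopf.IsConvInv b c) ∧
    -- the inverse of `b = b̃ ⋆ δ`, for the Hopf algebra `H`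
    (∀ b : TreeHopf.HCK k →ₗ[k] k, TreeHopf.IsCharacter b →
      b (TreeHopf.HCK.tree TreeHopf.RTree.dot) = 1 →
      ∀ b' : TreeHopf.H k →ₗ[k] k, TreeHopf.IsCharacter b' →
        b = TreeHopf.starH b' (TreeHopf.deltaChar k) →
        ∀ bInv deltaInv : TreeHopf.HCK k →ₗ[k] k,
          TreeHopf.IsConvInv b bInv → TreeHopf.IsConvInv (TreeHopf.deltaChar k) deltaInv →
          bInv = TreeHopf.starH b' deltaInv) ∧
    -- the inverse of `b = b̃ ⋆ δ`, for the bialgebra `H̃`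
    (∀ b : TreeHopf.HCK k →ₗ[k] k, TreeHopf.IsCharacter b →
      ∀ b' : TreeHopf.HTilde k →ₗ[k] k, TreeHopf.IsCharacter b' →
        b = TreeHopf.starHTilde b' (TreeHopf.deltaChar k) →
        ∀ bInv deltaInv : TreeHopf.HCK k →ₗ[k] k,
          TreeHopf.IsConvInv b bInv → TreeHopf.IsConvInv (TreeHopf.deltaChar k) deltaInv →
          bInv = TreeHopf.starHTilde b' deltaInv) := by
  have charTilde {φ : HTilde k →ₗ[k] k} (hφ : IsCharacter φ) :
      IsCharacter (starHTilde φ (deltaChar k)) :=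
    isCharacter_starHTilde hφ isCharacter_deltaChar
  have tilde (φ : H k →ₗ[k] k) (t : RTree) :
      (φ ∘ₗ projH.toLinearMap) (HTilde.tree t) = φ (H.tree t) :=
    congrArg φ (projH_tree t)
  have infH {φ : H k →ₗ[k] k} (hφ : IsCharacter φ) : IsInfChar (starH φ (deltaDot k)) ∧
      ∀ t, starH φ (deltaDot k) (HCK.tree t) = φ (H.tree t) := by
    rw [starH_eq]
    have h := isCharacter_comp_projH hφ
    exact ⟨isInfChar_starHTilde_deltaDot h,
      fun t => (starHTilde_deltaDot_tree h t).trans (tilde φ t)⟩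
  have charH {φ : H k →ₗ[k] k} (hφ : IsCharacter φ) : IsCharacter (starH φ (deltaChar k)) ∧
      ∀ t, starH φ (deltaChar k) (HCK.tree t) = φ (H.tree t) := by
    rw [starH_eq]
    have h := isCharacter_comp_projH hφ
    exact ⟨charTilde h, fun t => (starHTilde_deltaChar_tree h t).trans (tilde φ t)⟩
  refine ⟨⟨fun φ hφ ξ => ⟨?_, fun h => ?_⟩, fun φ hφ => ⟨?_, ?_⟩, fun φ hφ ψ hψ h => ?_,
      fun ξ hξ => ?_⟩,
    ⟨fun φ hφ b => ⟨?_, fun h => ?_⟩, fun φ hφ => ⟨?_, ?_⟩, fun φ hφ ψ hψ h => ?_,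
      fun b hb => ?_⟩,
    ⟨fun φ hφ ξ => ⟨?_, fun h => ?_⟩, fun φ hφ => ?_, fun φ hφ ψ hψ h => ?_, fun ξ hξ => ?_⟩,
    ⟨fun φ hφ b => ⟨?_, fun h => ?_⟩, fun φ hφ => ?_, fun φ hφ ψ hψ h => ?_, fun b hb => ?_⟩,
    isCharacter_deltaChar, fun b hb => ?_, fun b _ _ b' hb' h bInv deltaInv hbi hd => ?_,
    fun b _ b' hb' h bInv deltaInv hbi hd => ?_⟩
  · rintro rfl
    exact infH hφ
  · exact isInfChar_ext h.1 (infH hφ).1 fun t => (h.2 t).trans ((infH hφ).2 t).symm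
  · exact (infH hφ).1
  · exact ((infH hφ).2 _).trans (H_tree_dot (k := k) ▸ hφ.1)
  · refine isCharacter_ext_H hφ hψ fun t => ?_
    rw [← (infH hφ).2, ← (infH hψ).2]
    exact DFunLike.congr_fun h _
  · obtain ⟨φ, hφ, hv⟩ := exists_isCharacter_H (v := fun t => ξ (HCK.tree t)) hξ.2
    exact ⟨φ, hφ, isInfChar_ext (infH hφ).1 hξ.1 fun t => ((infH hφ).2 t).trans (hv t)⟩
  · rintro rfl
    exact charH hφ
  · exact isCharacter_ext h.1 (charH hφ).1 fun t => (h.2 t).trans ((charH hφ).2 t).symm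
  · exact (charH hφ).1
  · exact ((charH hφ).2 _).trans (H_tree_dot (k := k) ▸ hφ.1)
  · refine isCharacter_ext_H hφ hψ fun t => ?_
    rw [← (charH hφ).2, ← (charH hψ).2]
    exact DFunLike.congr_fun h _
  · obtain ⟨φ, hφ, hv⟩ := exists_isCharacter_H (v := fun t => b (HCK.tree t)) hb.2
    exact ⟨φ, hφ, isCharacter_ext (charH hφ).1 hb.1 fun t => ((charH hφ).2 t).trans (hv t)⟩
  · rintro rfl
    exact ⟨isInfChar_starHTilde_deltaDot hφ, starHTilde_deltaDot_tree hφ⟩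
  · exact isInfChar_ext h.1 (isInfChar_starHTilde_deltaDot hφ) fun t =>
      (h.2 t).trans (starHTilde_deltaDot_tree hφ t).symm
  · exact isInfChar_starHTilde_deltaDot hφ
  · refine isCharacter_ext hφ hψ fun t => ?_
    exact (starHTilde_deltaDot_tree hφ t).symm.trans
      ((DFunLike.congr_fun h _).trans (starHTilde_deltaDot_tree hψ t))
  · obtain ⟨φ, hφ, hv⟩ := exists_isCharacter_HTilde fun t => ξ (HCK.tree t)
    exact ⟨φ, hφ, isInfChar_ext (isInfChar_starHTilde_deltaDot hφ) hξ fun t =>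
      (starHTilde_deltaDot_tree hφ t).trans (hv t)⟩
  · rintro rfl
    exact ⟨charTilde hφ, starHTilde_deltaChar_tree hφ⟩
  · exact isCharacter_ext h.1 (charTilde hφ) fun t =>
      (h.2 t).trans (starHTilde_deltaChar_tree hφ t).symm
  · exact charTilde hφ
  · exact (starHTilde_deltaChar hφ).symm.trans (h.trans (starHTilde_deltaChar hψ))
  -- The preimage is `b` itself, as `H̃` and `H_CK` are the same algebra.
  · exact ⟨b, hb, starHTilde_deltaChar hb⟩
  · have h := isConvInv_starHTilde_signHom hb
    exact ⟨_, h, fun c hc => hc.unique h.2⟩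
  · rw [starH_eq] at h ⊢
    exact convInv_eq_starHTilde (isCharacter_comp_projH hb') (h ▸ hbi) hd
  · exact convInv_eq_starHTilde hb' (h ▸ hbi) hd
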